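/- All graphs are finite and simple. Let $G$ be a graph with vertex set $V(G)$. Given a set $B\subseteq V(G)$ of blue vertices (the others being white), the PSD color change rule allows a blue vertex $u$ to change a white vertex $w$ to blue if $w$ is the only neighbor of $u$ in the connected component of $G[V(G)\setminus B]$ that contains $w$. A set $S\subseteq V(G)$ is a PSD (zero) forcing set of $G$ if, starting with exactly the vertices of $S$ blue, repeated application of this rule colors all of $V(G)$ blue. The PSD forcing TAR graph $\mathfrak{Z}^+(G)$ has the PSD forcing sets of $G$ as its vertices, and $S_1,S_2$ are adjacent if and only if $|S_1\ominus S_2|=1$, where $\ominus$ denotes symmetric difference. For every integer $q\ge 2$, the PSD forcing TAR graph of the complete bipartite graph $K_{2,q}$ (which has no isolated vertices) is unique; that is, if $G$ is a graph with no isolated vertices and $\mathfrak{Z}^+(G)\cong\mathfrak{Z}^+(K_{2,q})$, then $G\cong K_{2,q}$. -/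

import Mathlib

universe u v

/-- The PSD color change rule: with blue set `B`, the blue vertex `u` can color the white vertex `w`
blue if `w` is the only neighbor of `u` in the connected component of `w` in `G[V ∖ B]`. -/
def PSDForces {V : Type u} (G : SimpleGraph V) (B : Set V) (u w : V) : Prop :=
  u ∈ B ∧ G.Adj u w ∧ ∃ hw : w ∈ Bᶜ, ∀ x : ↥(Bᶜ),
    (G.induce Bᶜ).Reachable ⟨w, hw⟩ x → G.Adj u x → (x : V) = w

/-- One application of the PSD color change rule turns the blue set `B` into `B'`. -/
def PSDStep {V : Type u} (G : SimpleGraph V) (B B' : Set V) : Prop :=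
  ∃ u w : V, PSDForces G B u w ∧ B' = insert w B

/-- `T` is a PSD final coloring of `S`: it arises from `S` by repeated applications of the
PSD color change rule, and no further change is possible. -/
def IsPSDFinalColoring {V : Type u} (G : SimpleGraph V) (S T : Set V) : Prop :=
  Relation.ReflTransGen (PSDStep G) S T ∧ ∀ T' : Set V, ¬ PSDStep G T T'

/-- `S` is a PSD zero forcing set of `G`. -/
def IsPSDForcingSet {V : Type u} (G : SimpleGraph V) (S : Set V) : Prop :=
  IsPSDFinalColoring G S Set.univ

/-- The PSD forcing TAR graph of `G`: its vertices are the PSD zero forcing sets of `G`, and two are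
adjacent when their symmetric difference has exactly one element. -/
def psdTARGraph {V : Type u} (G : SimpleGraph V) :
    SimpleGraph {S : Set V // IsPSDForcingSet G S} where
  Adj S T := (symmDiff (S : Set V) (T : Set V)).ncard = 1
  symm := ⟨fun S T h => by rwa [symmDiff_comm]⟩
  loopless := ⟨fun S h => by simp at h⟩

/-- `H` (a graph without isolated vertices) has a unique PSD forcing TAR graph: every finite graph
`G` without isolated vertices whose TAR graph is isomorphic to that of `H` is isomorphic to `H`. -/
def HasUniquePSDTARGraph {W : Type v} (H : SimpleGraph W) : Prop :=
  (∀ w : W, ¬ H.IsIsolated w) ∧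
    ∀ (V : Type u) [Finite V] (G : SimpleGraph V), (∀ x : V, ¬ G.IsIsolated x) →
      Nonempty (psdTARGraph G ≃g psdTARGraph H) → Nonempty (G ≃g H)

/-! ### Forces and monotonicity of forcing sets. -/

section Forcing

variable {V : Type u} {G : SimpleGraph V} {B S T : Set V} {u w x y : V}

theorem PSDForces.not_adj (h : PSDForces G B u w) (hx : x ∉ B) (hux : G.Adj u x) :
    ¬ G.Adj w x := by
  intro hwx
  obtain ⟨-, -, hw, H⟩ := h
  have hr : (G.induce Bᶜ).Reachable ⟨w, hw⟩ ⟨x, hx⟩ := SimpleGraph.Adj.reachable (by simpa using hwx)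
  exact hwx.ne (H ⟨x, hx⟩ hr hux).symm

/-- White paths of length one and two are the only connectivity needed to rule out forces below. -/
theorem PSDForces.eq_of_adj_adj (h : PSDForces G B u w) (hx : x ∉ B) (hux : G.Adj u x)
    (hy : y ∉ B) (hwy : G.Adj w y) (hyx : G.Adj y x) : x = w := by
  obtain ⟨-, -, hw, H⟩ := h
  have h₁ : (G.induce Bᶜ).Reachable ⟨w, hw⟩ ⟨y, hy⟩ := SimpleGraph.Adj.reachable (by simpa using hwy)
  have h₂ : (G.induce Bᶜ).Reachable ⟨y, hy⟩ ⟨x, hx⟩ := SimpleGraph.Adj.reachable (by simpa using hyx)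
  exact H ⟨x, hx⟩ (h₁.trans h₂) hux

theorem psdForces_of_unique (hu : u ∈ B) (huw : G.Adj u w) (hw : w ∉ B)
    (h : ∀ x ∉ B, G.Adj u x → x = w) : PSDForces G B u w :=
  ⟨hu, huw, hw, fun x _ hx => h x x.2 hx⟩

theorem psdForces_of_isolated (hu : u ∈ B) (huw : G.Adj u w) (hw : w ∉ B)
    (h : ∀ x ∉ B, ¬ G.Adj w x) : PSDForces G B u w := by
  refine ⟨hu, huw, hw, fun x hr _ => ?_⟩
  obtain ⟨p⟩ := hr
  cases p with
  | nil => rfl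
  | @cons _ y _ hadj _ =>
    exact absurd (by simpa using hadj) (h y y.2)

/-- More blue vertices only shrink the white components. -/
theorem PSDForces.mono (h : PSDForces G B u w) (hBS : B ⊆ S) (hw : w ∉ S) :
    PSDForces G S u w := by
  obtain ⟨hu, huw, hwB, H⟩ := h
  refine ⟨hBS hu, huw, hw, fun x hr hux => ?_⟩
  have hle : Sᶜ ⊆ Bᶜ := Set.compl_subset_compl.2 hBS
  exact H ⟨x, hle x.2⟩ (hr.map (SimpleGraph.induceHomOfLE G hle).toHom) hux

theorem isPSDForcingSet_iff :
    IsPSDForcingSet G S ↔ Relation.ReflTransGen (PSDStep G) S Set.univ := by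
  refine ⟨fun h => h.1, fun h => ⟨h, ?_⟩⟩
  rintro T' ⟨u, w, ⟨-, -, hw, -⟩, -⟩
  exact hw (Set.mem_univ w)

/-- The same forces are replayed from `T`, skipping vertices already blue. -/
theorem IsPSDForcingSet.mono (h : IsPSDForcingSet G S) (hST : S ⊆ T) : IsPSDForcingSet G T := by
  rw [isPSDForcingSet_iff] at *
  have key : ∀ R, Relation.ReflTransGen (PSDStep G) S R →
      ∃ R', R ⊆ R' ∧ Relation.ReflTransGen (PSDStep G) T R' := by
    intro R hR
    induction hR with
    | refl => exact ⟨T, hST, .refl⟩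
    | tail _ hstep ih =>
      obtain ⟨R', hsub, hR'⟩ := ih
      obtain ⟨u, w, hf, rfl⟩ := hstep
      by_cases hw : w ∈ R'
      · exact ⟨R', Set.insert_subset hw hsub, hR'⟩
      · exact ⟨insert w R', Set.insert_subset_insert hsub,
          hR'.tail ⟨u, w, hf.mono hsub hw, rfl⟩⟩
  obtain ⟨R', hsub, hR'⟩ := key _ h
  rwa [Set.univ_subset_iff.1 hsub] at hR'

theorem isPSDForcingSet_univ : IsPSDForcingSet G Set.univ :=
  isPSDForcingSet_iff.2 .refl

theorem IsPSDForcingSet.of_insert (hf : PSDForces G S u w) (h : IsPSDForcingSet G (insert w S)) :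
    IsPSDForcingSet G S :=
  isPSDForcingSet_iff.2 (.head ⟨u, w, hf, rfl⟩ (isPSDForcingSet_iff.1 h))

theorem IsPSDForcingSet.exists_forces (h : IsPSDForcingSet G S) (hx : x ∉ S) :
    ∃ u w, PSDForces G S u w := by
  rw [isPSDForcingSet_iff] at h
  rcases h.cases_head with rfl | ⟨R, ⟨u, w, hf, -⟩, -⟩
  · exact absurd (Set.mem_univ x) hx
  · exact ⟨u, w, hf⟩

theorem isPSDForcingSet_of_forall_superset [Finite V]
    (h : ∀ T, S ⊆ T → T ≠ Set.univ → ∃ u w, PSDForces G T u w) : IsPSDForcingSet G S := by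
  suffices ∀ n, ∀ T, S ⊆ T → Tᶜ.ncard = n → IsPSDForcingSet G T from this _ S le_rfl rfl
  intro n
  induction n with
  | zero =>
    intro T _ hT
    rw [Set.ncard_eq_zero, Set.compl_empty_iff] at hT
    exact hT ▸ isPSDForcingSet_univ
  | succ n ih =>
    intro T hST hT
    obtain ⟨u, w, hf⟩ := h T hST (by rintro rfl; simp at hT)
    refine .of_insert hf (ih _ (hST.trans (Set.subset_insert _ _)) ?_)
    have hw : w ∈ Tᶜ := hf.2.2.1
    have hc : (insert w T)ᶜ = Tᶜ \ {w} := by ext; simp [not_or, and_comm]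
    rw [hc, Set.ncard_sdiff_singleton_of_mem hw, hT, Nat.add_sub_cancel]

theorem isPSDForcingSet_compl_singleton {v : V} (hv : ¬ G.IsIsolated v) :
    IsPSDForcingSet G {v}ᶜ := by
  obtain ⟨u, hu⟩ : ∃ u, G.Adj v u := by
    by_contra! hcon
    exact hv (by simpa [SimpleGraph.IsIsolated] using hcon)
  refine .of_insert (u := u) (w := v)
    (psdForces_of_unique (by simpa using hu.ne') hu.symm (by simp) (by simp)) ?_
  convert isPSDForcingSet_univ using 1
  ext; simp [em]

end Forcing

/-! ### TAR isomorphisms are relabelings of vertices. -/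

section Relabeling

variable {V : Type u} {W : Type v} {G : SimpleGraph V} {H : SimpleGraph W}

theorem symmDiff_eq_singleton_iff {α : Type u} {A B : Set α} {x : α} :
    symmDiff A B = {x} ↔ B = symmDiff A {x} := by
  constructor
  · rintro h; rw [← h, symmDiff_symmDiff_cancel_left]
  · rintro rfl; exact symmDiff_symmDiff_cancel_left _ _

/-- Two sets that both differ in one element from `symmDiff A {x}` and from `symmDiff A {y}`,
`x ≠ y`: there are only two of them. -/
theorem eq_or_eq_of_ncard_symmDiff {α : Type u} {A C : Set α} {x y : α} (hxy : x ≠ y)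
    (hx : (symmDiff (symmDiff A {x}) C).ncard = 1)
    (hy : (symmDiff (symmDiff A {y}) C).ncard = 1) :
    C = A ∨ C = symmDiff (symmDiff A {x}) {y} := by
  obtain ⟨z, hz⟩ := Set.ncard_eq_one.1 hx
  obtain ⟨t, ht⟩ := Set.ncard_eq_one.1 hy
  rw [symmDiff_eq_singleton_iff] at hz ht
  by_cases h : z = x
  · left; rw [hz, h, symmDiff_symmDiff_cancel_right]
  · right
    have hzt : symmDiff ({x} : Set α) {z} = symmDiff {y} {t} := by
      rw [symmDiff_assoc] at hz ht
      exact symmDiff_right_injective A (hz.symm.trans ht)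
    have hy' : z = y := by
      have h₁ : z ∈ symmDiff ({x} : Set α) {z} := by simp [Set.mem_symmDiff, h]
      have h₂ : x ∈ symmDiff ({x} : Set α) {z} := by simp [Set.mem_symmDiff, Ne.symm h]
      rw [hzt] at h₁ h₂
      simp only [Set.mem_symmDiff, Set.mem_singleton_iff] at h₁ h₂
      grind
    rw [hz, hy']

/-- An isomorphism of TAR graphs maps `S` to `symmDiff S₀ (π '' Sᶜ)`, where `S₀` is the image of the
full vertex set and `π` is an injection. -/
theorem psdTARGraph_iso_apply [Finite V] (hG : ∀ x, ¬ G.IsIsolated x)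
    (φ : psdTARGraph G ≃g psdTARGraph H) :
    ∃ π : V → W, Function.Injective π ∧ ∀ S : {S : Set V // IsPSDForcingSet G S},
      (φ S : Set W) = symmDiff (φ ⟨Set.univ, isPSDForcingSet_univ⟩ : Set W) (π '' (S : Set V)ᶜ) := by
  set S₀ : Set W := (φ ⟨Set.univ, isPSDForcingSet_univ⟩ : Set W) with hS₀
  have hadj : ∀ S T : {S : Set V // IsPSDForcingSet G S},
      (symmDiff (S : Set V) T).ncard = 1 → (symmDiff (φ S : Set W) (φ T)).ncard = 1 :=
    fun S T h => φ.map_adj_iff.2 h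
  have hco : ∀ v : V, ∃ w : W,
      (φ ⟨{v}ᶜ, isPSDForcingSet_compl_singleton (hG v)⟩ : Set W) = symmDiff S₀ {w} := by
    intro v
    have h := hadj ⟨Set.univ, isPSDForcingSet_univ⟩
      ⟨{v}ᶜ, isPSDForcingSet_compl_singleton (hG v)⟩ (by
        have : symmDiff (Set.univ : Set V) {v}ᶜ = {v} := by
          ext; simp [Set.mem_symmDiff]
        rw [this]; simp)
    obtain ⟨w, hw⟩ := Set.ncard_eq_one.1 h
    exact ⟨w, symmDiff_eq_singleton_iff.1 hw⟩
  choose π hπ using hco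
  have hinj : Function.Injective π := by
    intro v v' h
    have h' := (hπ v).trans ((congrArg (fun w => symmDiff S₀ {w}) h).trans (hπ v').symm)
    have := congrArg Subtype.val (φ.injective (Subtype.ext h'))
    simpa using this
  refine ⟨π, hinj, ?_⟩
  suffices ∀ n, ∀ S : {S : Set V // IsPSDForcingSet G S}, (S : Set V)ᶜ.ncard = n →
      (φ S : Set W) = symmDiff S₀ (π '' (S : Set V)ᶜ) from fun S => this _ S rfl
  intro n
  induction n using Nat.strong_induction_on with
  | _ n ih =>
  rintro ⟨S, hS⟩ hn
  rcases Set.eq_empty_or_nonempty Sᶜ with h0 | ⟨v, hv⟩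
  · obtain rfl := Set.compl_empty_iff.1 h0
    rw [Set.compl_univ, Set.image_empty, ← Set.bot_eq_empty, symmDiff_bot]
  by_cases h1 : ∃ v' ∈ Sᶜ, v' ≠ v
  · obtain ⟨v', hv', hne⟩ := h1
    have hlt : ∀ T : Set V, S ⊆ T → v ∈ T ∨ v' ∈ T → Tᶜ.ncard < n := by
      intro T hST hT
      rw [← hn]
      refine Set.ncard_lt_ncard ⟨Set.compl_subset_compl.2 hST, fun hsub => ?_⟩
      exact hT.elim (hsub hv) (hsub hv')
    have himg : ∀ (T : Set V) (t : V), t ∉ T →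
        π '' (insert t T)ᶜ = symmDiff (π '' Tᶜ) {π t} := by
      intro T t ht
      ext w
      simp only [Set.mem_symmDiff, Set.mem_image, Set.mem_compl_iff, Set.mem_insert_iff,
        Set.mem_singleton_iff]
      constructor
      · rintro ⟨s, hs, rfl⟩
        exact .inl ⟨⟨s, fun h => hs (.inr h), rfl⟩, fun h => hs (.inl (hinj h))⟩
      · rintro (⟨⟨s, hs, rfl⟩, h⟩ | ⟨rfl, h⟩)
        · exact ⟨s, fun h' => h'.elim (fun e => h (e ▸ rfl)) hs, rfl⟩
        · exact absurd ⟨t, ht, rfl⟩ h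
    have hd : ∀ (T : Set V) (t : V), t ∉ T → (symmDiff (insert t T) T).ncard = 1 := by
      intro T t ht
      have : symmDiff (insert t T) T = {t} := by
        ext x
        simp only [Set.mem_symmDiff, Set.mem_insert_iff, Set.mem_singleton_iff]
        grind
      rw [this]; simp
    have e₁ := ih _ (hlt _ (Set.subset_insert v S) (.inl (by simp)))
      ⟨insert v S, hS.mono (Set.subset_insert _ _)⟩ rfl
    have e₂ := ih _ (hlt _ (Set.subset_insert v' S) (.inr (by simp)))
      ⟨insert v' S, hS.mono (Set.subset_insert _ _)⟩ rfl
    have hv'' : v' ∉ insert v S := by simp [hne]; exact hv'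
    have hsub : S ⊆ insert v' (insert v S) :=
      (Set.subset_insert _ _).trans (Set.subset_insert _ _)
    have e₃ := ih _ (hlt _ hsub (.inr (by simp))) ⟨insert v' (insert v S), hS.mono hsub⟩ rfl
    have a₁ := hadj ⟨insert v S, hS.mono (Set.subset_insert _ _)⟩ ⟨S, hS⟩ (hd S v hv)
    have a₂ := hadj ⟨insert v' S, hS.mono (Set.subset_insert _ _)⟩ ⟨S, hS⟩ (hd S v' hv')
    simp only at e₁ e₂ e₃
    rw [himg _ _ hv, ← symmDiff_assoc] at e₁
    rw [himg _ _ hv', ← symmDiff_assoc] at e₂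
    rw [himg _ _ hv'', himg _ _ hv, ← symmDiff_assoc, ← symmDiff_assoc] at e₃
    rw [e₁] at a₁
    rw [e₂] at a₂
    -- The images of `insert v S` and `insert v' S` have only two common neighbors in the hypercube.
    -- One is the image of `insert v' (insert v S)`, so injectivity leaves the other for `S`.
    rcases eq_or_eq_of_ncard_symmDiff (fun h => hne (hinj h).symm) a₁ a₂ with h | h
    · exact h
    · have := congrArg Subtype.val (φ.injective (Subtype.ext (h.trans e₃.symm)))
      simp only at this
      exact absurd (this ▸ Set.mem_insert v' _ : v' ∈ S) hv'
  · push Not at h1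
    have hc : Sᶜ = {v} := by
      ext x; exact ⟨fun h => h1 x h, fun h => h ▸ hv⟩
    obtain rfl : S = {v}ᶜ := by rw [← hc, compl_compl]
    simpa using hπ v

/-- Finite graphs without isolated vertices whose TAR graphs are isomorphic have the same PSD
forcing sets up to a relabeling of the vertices. -/
theorem exists_equiv_isPSDForcingSet_iff [Finite V] [Finite W] (hG : ∀ x, ¬ G.IsIsolated x)
    (hH : ∀ x, ¬ H.IsIsolated x) (φ : psdTARGraph G ≃g psdTARGraph H) :
    ∃ e : V ≃ W, ∀ S : Set V, IsPSDForcingSet G S ↔ IsPSDForcingSet H (e '' S) := by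
  obtain ⟨π, hπ, hφ⟩ := psdTARGraph_iso_apply hG φ
  obtain ⟨ρ, hρ, -⟩ := psdTARGraph_iso_apply hH φ.symm
  have hcard : Nat.card V = Nat.card W :=
    le_antisymm (Nat.card_le_card_of_injective π hπ) (Nat.card_le_card_of_injective ρ hρ)
  have hbij : Function.Bijective π :=
    (Nat.bijective_iff_injective_and_card π).2 ⟨hπ, hcard⟩
  set S₀ : Set W := (φ ⟨Set.univ, isPSDForcingSet_univ⟩ : Set W)
  have hφ' : ∀ S : {S : Set V // IsPSDForcingSet G S},
      (φ S : Set W) = symmDiff (π '' (S : Set V)) S₀ᶜ := by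
    intro S
    rw [hφ S, Set.image_compl_eq hbij]
    ext w
    simp only [Set.mem_symmDiff, Set.mem_compl_iff]
    tauto
  have hfwd : ∀ S, IsPSDForcingSet G S → IsPSDForcingSet H (symmDiff (π '' S) S₀ᶜ) :=
    fun S hS => hφ' ⟨S, hS⟩ ▸ (φ ⟨S, hS⟩).2
  have hbwd : ∀ S, IsPSDForcingSet H (symmDiff (π '' S) S₀ᶜ) → IsPSDForcingSet G S := by
    intro S hS
    obtain ⟨⟨T, hT⟩, hTS⟩ := φ.surjective ⟨_, hS⟩
    have h := (hφ' ⟨T, hT⟩).symm.trans (congrArg Subtype.val hTS)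
    rwa [← hπ.image_injective (symmDiff_left_injective _ h)]
  refine ⟨Equiv.ofBijective π hbij, fun S => ?_⟩
  change _ ↔ IsPSDForcingSet H (π '' S)
  constructor
  · intro hS
    -- After this enlargement the twist by `S₀ᶜ` only deletes points, so the image lies inside `π ''
    -- S`.
    have hU := hfwd _ (hS.mono (Set.subset_union_left (t := π ⁻¹' S₀ᶜ)))
    refine hU.mono ?_
    rw [Set.image_union, Set.image_preimage_eq _ hbij.surjective]
    intro w
    simp only [Set.mem_symmDiff, Set.mem_union]
    tauto
  · intro hS
    -- Dually, the twist now only adds points, so the image contains `π '' S`.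
    have hU := hbwd (S \ π ⁻¹' S₀ᶜ) (by
      refine hS.mono ?_
      rw [Set.image_sdiff hπ, Set.image_preimage_eq _ hbij.surjective]
      intro w
      simp only [Set.mem_symmDiff, Set.mem_sdiff]
      tauto)
    exact hU.mono Set.sdiff_subset

end Relabeling

/-! ### Recovering the edges from the forcing sets. -/

section Structure

variable {V : Type u} {G : SimpleGraph V} {a b : V}

/-- The case in which `a` and `b` are not adjacent. -/
theorem adj_iff_of_not_adj (hne : a ≠ b) (hG : ∀ x, ¬ G.IsIsolated x)
    (hstuck : ∀ k, k ≠ a → k ≠ b → ∀ u w, ¬ PSDForces G {a, b, k}ᶜ u w)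
    (hab : IsPSDForcingSet G {a, b}) (ha : ∀ i, i ≠ a → i ≠ b → IsPSDForcingSet G {a, i})
    (hadj : ¬ G.Adj a b) (x y : V) :
    G.Adj x y ↔ (x ∈ ({a, b} : Set V) ↔ y ∉ ({a, b} : Set V)) := by
  have hba : ¬ G.Adj b a := fun h => hadj h.symm
  have key : ∀ c ∈ ({a, b} : Set V), ∀ k, k ≠ a → k ≠ b → G.Adj c k := by
    intro c hc k hka hkb
    by_contra hck
    obtain ⟨u, hu⟩ : ∃ u, G.Adj c u := by
      by_contra! hcon; exact hG c hcon
    have hw : ∀ x ∉ ({a, b, k} : Set V)ᶜ, ¬ G.Adj c x := by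
      intro x hx
      simp only [Set.mem_compl_iff, not_not, Set.mem_insert_iff, Set.mem_singleton_iff] at hx hc
      rcases hc with rfl | rfl <;> rcases hx with rfl | rfl | rfl <;> simp_all
    -- With only `a`, `b`, `k` white, `c` has no white neighbor, so its neighbor `u` would force it.
    refine hstuck k hka hkb u c (psdForces_of_isolated ?_ hu.symm ?_ hw)
    · by_contra h; exact hw u h hu
    · simp only [Set.mem_compl_iff, not_not, Set.mem_insert_iff, Set.mem_singleton_iff] at hc ⊢
      tauto
  have hak := key a (by simp)
  have hbk := key b (by simp)
  have indep : ∀ i j, i ≠ a → i ≠ b → j ≠ a → j ≠ b → ¬ G.Adj i j := by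
    intro i j hia hib hja hjb hij
    by_cases hl : ∃ l, l ≠ a ∧ l ≠ b ∧ l ≠ i ∧ l ≠ j
    · obtain ⟨l, hla, hlb, hli, hlj⟩ := hl
      -- The white vertex `b` is adjacent to all other white vertices, so the white graph is
      -- connected; yet `a` has white neighbors `j`, `l`, and `i` has `b`, `j`.
      obtain ⟨u, w, hf⟩ := (ha i hia hib).exists_forces (x := b) (by simp [hne.symm, hib.symm])
      have hu := hf.1
      have huw := hf.2.1
      have hw : w ∉ ({a, i} : Set V) := hf.2.2.1
      simp only [Set.mem_insert_iff, Set.mem_singleton_iff, not_or] at hu hw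
      rcases hu with rfl | rfl
      · have hwb : w ≠ b := by rintro rfl; exact hadj huw
        have hx : ∀ x, x ≠ u → x ≠ b → x ≠ i → x = w := fun x hxa hxb hxi =>
          hf.eq_of_adj_adj (y := b) (by simp [hxa, hxi]) (hak x hxa hxb)
            (by simp [hne.symm, hib.symm]) (hbk w hw.1 hwb).symm (hbk x hxa hxb)
        exact hlj ((hx l hla hlb hli).trans (hx j hja hjb hij.ne').symm)
      · by_cases hwb : w = b
        · subst hwb
          exact hf.not_adj (x := j) (by simp [hja, hij.ne']) hij (hbk j hja hjb)
        · exact hf.not_adj (x := b) (by simp [hne.symm, hib.symm]) (hbk u hia hib).symm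
            (hbk w hw.1 hwb).symm
    · push Not at hl
      obtain ⟨u, w, hf⟩ := hab.exists_forces (x := i) (by simp [hia, hib])
      have hu := hf.1
      have huw := hf.2.1
      have hw : w ∉ ({a, b} : Set V) := hf.2.2.1
      simp only [Set.mem_insert_iff, Set.mem_singleton_iff, not_or] at hu hw
      have hall : ∀ k, k ≠ a → k ≠ b → G.Adj u k := by rcases hu with rfl | rfl <;> assumption
      by_cases hwi : w = i
      · subst hwi
        exact hf.not_adj (x := j) (by simp [hja, hjb]) (hall j hja hjb) hij
      · obtain rfl := hl w hw.1 hw.2 hwi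
        exact hf.not_adj (x := i) (by simp [hia, hib]) (hall i hia hib) hij.symm
  simp only [Set.mem_insert_iff, Set.mem_singleton_iff]
  by_cases hx : x = a ∨ x = b <;> by_cases hy : y = a ∨ y = b
  · rcases hx with rfl | rfl <;> rcases hy with rfl | rfl <;> simp_all
  · have : G.Adj x y := by
      rw [not_or] at hy
      rcases hx with rfl | rfl
      exacts [hak y hy.1 hy.2, hbk y hy.1 hy.2]
    tauto
  · have : G.Adj x y := by
      rw [not_or] at hx
      rcases hy with rfl | rfl
      exacts [(hak x hx.1 hx.2).symm, (hbk x hx.1 hx.2).symm]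
    tauto
  · have := indep x y (fun h => hx (.inl h)) (fun h => hx (.inr h)) (fun h => hy (.inl h))
      (fun h => hy (.inr h))
    tauto

/-- The case in which `a` and `b` are adjacent and `j` is the only other neighbor of `b`. -/
theorem adj_iff_of_adj_of_unique_neighbor {i j : V} (hne : a ≠ b) (hadj : G.Adj a b)
    (hcov : ∀ k, k ≠ a → k ≠ b → G.Adj a k ∨ G.Adj b k)
    (hcl : ∀ i k, i ≠ a → i ≠ b → k ≠ a → k ≠ b → i ≠ k → G.Adj a i → ¬ G.Adj b i → G.Adj i k)
    (hb : ∀ i, i ≠ a → i ≠ b → IsPSDForcingSet G {b, i})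
    (hja : j ≠ a) (hjb : j ≠ b) (hbj : G.Adj b j)
    (hunique : ∀ x, x ≠ a → G.Adj b x → x = j)
    (hia : i ≠ a) (hib : i ≠ b) (hij : i ≠ j) (x y : V) :
    G.Adj x y ↔ (x ∈ ({a, j} : Set V) ↔ y ∉ ({a, j} : Set V)) := by
  have hnb : ∀ k, k ≠ a → k ≠ j → ¬ G.Adj b k := fun k hka hkj h => hkj (hunique k hka h)
  have hak : ∀ k, k ≠ a → k ≠ b → k ≠ j → G.Adj a k := fun k hka hkb hkj =>
    (hcov k hka hkb).resolve_right (hnb k hka hkj)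
  have hclique : ∀ k l, k ≠ a → k ≠ b → l ≠ a → l ≠ b → k ≠ l → G.Adj k l := by
    intro k l hka hkb hla hlb hkl
    by_cases hkj : k = j
    · have hlj : l ≠ j := fun h => hkl (hkj.trans h.symm)
      exact (hcl l k hla hlb hka hkb hkl.symm (hak l hla hlb hlj) (hnb l hla hlj)).symm
    · exact hcl k l hka hkb hla hlb hkl (hak k hka hkb hkj) (hnb k hka hkj)
  obtain ⟨u, w, hf⟩ := (hb i hia hib).exists_forces (x := a) (by simp [hne, hia.symm])
  have hu := hf.1
  have huw := hf.2.1
  have hw : w ∉ ({b, i} : Set V) := hf.2.2.1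
  simp only [Set.mem_insert_iff, Set.mem_singleton_iff, not_or] at hu hw
  -- A further vertex `l` would be adjacent to every other white vertex, making the white graph
  -- connected, while `b` and `i` each have two white neighbors.
  have hall : ∀ l, l ≠ a → l ≠ b → l ≠ i → l = j := by
    intro l hla hlb hli
    by_contra hlj
    rcases hu with rfl | rfl
    · by_cases hwa : w = a
      · subst hwa
        exact hja (hf.eq_of_adj_adj (y := l) (by simp [hjb, hij.symm]) hbj (by simp [hlb, hli])
          (hak l hla hlb hlj) (hclique l j hla hlb hja hjb hlj))
      · obtain rfl := hunique w hwa huw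
        exact hwa (hf.eq_of_adj_adj (y := l) (by simp [hne, hia.symm]) hadj.symm
          (by simp [hlb, hli]) (hclique w l hja hjb hla hlb (Ne.symm hlj))
          (hak l hla hlb hlj).symm).symm
    · by_cases hwl : w = l
      · subst hwl
        exact hf.not_adj (x := j) (by simp [hjb, hij.symm]) (hclique u j hia hib hja hjb hij)
          (hclique w j hla hlb hja hjb hlj)
      · refine hf.not_adj (x := l) (by simp [hlb, hli]) (hclique u l hia hib hla hlb hli.symm) ?_
        by_cases hwa : w = a
        · exact hwa ▸ hak l hla hlb hlj
        · exact hclique w l hwa hw.1 hla hlb hwl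
  have haj : ¬ G.Adj a j := by
    intro haj
    have huaj : G.Adj u a ∧ G.Adj u j := by
      rcases hu with rfl | rfl
      exacts [⟨hadj.symm, hbj⟩, ⟨(hak u hia hib hij).symm, hclique u j hia hib hja hjb hij⟩]
    by_cases hwa : w = a
    · subst hwa
      exact hf.not_adj (x := j) (by simp [hjb, hij.symm]) huaj.2 haj
    · obtain rfl := hall w hwa hw.1 hw.2
      exact hf.not_adj (x := a) (by simp [hne, hia.symm]) huaj.1 haj.symm
  have hai := hak i hia hib hij
  have hbi := hnb i hia hij
  have hijadj := hclique i j hia hib hja hjb hij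
  have hV : ∀ x, x = a ∨ x = b ∨ x = i ∨ x = j := fun x => by
    by_contra! h; exact h.2.2.2 (hall x h.1 h.2.1 h.2.2.1)
  simp only [Set.mem_insert_iff, Set.mem_singleton_iff]
  have hcomm := G.adj_comm
  have hirr : ∀ v, ¬ G.Adj v v := fun _ => G.irrefl
  rcases hV x with rfl | rfl | rfl | rfl <;> rcases hV y with rfl | rfl | rfl | rfl <;> grind

/-- The side `{c, d}` need not be `{a, b}`: in the four-cycle every pair of vertices is forcing, so
`a` and `b` may be adjacent. -/
theorem exists_adj_iff (hne : a ≠ b) (hG : ∀ x, ¬ G.IsIsolated x)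
    (hQ2 : ∀ k, ∃ l, l ≠ a ∧ l ≠ b ∧ l ≠ k)
    (hstuck : ∀ k, k ≠ a → k ≠ b → ∀ u w, ¬ PSDForces G {a, b, k}ᶜ u w)
    (hab : IsPSDForcingSet G {a, b}) (ha : ∀ i, i ≠ a → i ≠ b → IsPSDForcingSet G {a, i})
    (hb : ∀ i, i ≠ a → i ≠ b → IsPSDForcingSet G {b, i}) (hQ : IsPSDForcingSet G {a, b}ᶜ) :
    ∃ c d, c ≠ d ∧ ∀ x y, G.Adj x y ↔ (x ∈ ({c, d} : Set V) ↔ y ∉ ({c, d} : Set V)) := by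
  by_cases hadj : G.Adj a b
  swap
  · exact ⟨a, b, hne, adj_iff_of_not_adj hne hG hstuck hab ha hadj⟩
  have hcov : ∀ k, k ≠ a → k ≠ b → G.Adj a k ∨ G.Adj b k := by
    intro k hka hkb
    by_contra! hk
    obtain ⟨u, hu⟩ : ∃ u, G.Adj k u := by
      by_contra! hcon; exact hG k hcon
    have hw : ∀ x ∉ ({a, b, k} : Set V)ᶜ, ¬ G.Adj k x := by
      intro x hx
      simp only [Set.mem_compl_iff, not_not, Set.mem_insert_iff, Set.mem_singleton_iff] at hx
      rcases hx with rfl | rfl | rfl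
      exacts [fun h => hk.1 h.symm, fun h => hk.2 h.symm, G.irrefl]
    refine hstuck k hka hkb u k (psdForces_of_isolated ?_ hu.symm (by simp) hw)
    by_contra h; exact hw u h hu
  have hcl : ∀ c ∈ ({a, b} : Set V), ∀ d ∈ ({a, b} : Set V), c ≠ d → ∀ i k, i ≠ a → i ≠ b →
      k ≠ a → k ≠ b → i ≠ k → G.Adj c i → ¬ G.Adj d i → G.Adj i k := by
    intro c hc d hd hcd i k hia hib hka hkb hik hci hdi
    by_contra hnik
    -- Without the edge `i k`, the only white neighbor of `i` would be `c`.
    refine hstuck k hka hkb i c (psdForces_of_unique (by simp [hia, hib, hik]) hci.symm ?_ ?_)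
    · simp only [Set.mem_compl_iff, not_not, Set.mem_insert_iff, Set.mem_singleton_iff] at hc ⊢
      tauto
    · intro x hx hix
      simp only [Set.mem_compl_iff, not_not, Set.mem_insert_iff, Set.mem_singleton_iff] at hc hd hx
      have hxk : x ≠ k := by rintro rfl; exact hnik hix
      have hxd : x ≠ d := by rintro rfl; exact hdi hix.symm
      grind
  have hcla := hcl a (by simp) b (by simp) hne
  have hclb := hcl b (by simp) a (by simp) hne.symm
  -- As `a`, `b` are adjacent, the first force from `{a, b}ᶜ` has a source adjacent to exactly one
  -- of them, and `hcl` applies to it.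
  obtain ⟨i, hia, hib, hi⟩ : ∃ i, i ≠ a ∧ i ≠ b ∧ ∀ k, k ≠ a → k ≠ b → i ≠ k → G.Adj i k := by
    obtain ⟨u, w, hf⟩ := hQ.exists_forces (x := a) (by simp)
    have hu : u ∉ ({a, b} : Set V) := hf.1
    have huw := hf.2.1
    have hw : w ∈ ({a, b} : Set V) := not_not.1 hf.2.2.1
    simp only [Set.mem_insert_iff, Set.mem_singleton_iff, not_or] at hu hw
    refine ⟨u, hu.1, hu.2, fun k hka hkb huk => ?_⟩
    rcases hw with rfl | rfl
    · exact hcla u k hu.1 hu.2 hka hkb huk huw.symm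
        fun h => hf.not_adj (x := b) (by simp) h.symm hadj
    · exact hclb u k hu.1 hu.2 hka hkb huk huw.symm
        fun h => hf.not_adj (x := a) (by simp) h.symm hadj.symm
  obtain ⟨u, w, hf⟩ := hab.exists_forces (x := i) (by simp [hia, hib])
  have hu := hf.1
  have huw := hf.2.1
  have hw : w ∉ ({a, b} : Set V) := hf.2.2.1
  simp only [Set.mem_insert_iff, Set.mem_singleton_iff, not_or] at hu hw
  -- The vertex `i` makes the white graph connected, so `u` has a single white neighbor.
  have huniq : ∀ x, x ≠ a → x ≠ b → G.Adj u x → x = w := by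
    intro x hxa hxb hux
    by_contra hxw
    by_cases hwi : w = i
    · exact hf.not_adj (x := x) (by simp [hxa, hxb]) hux
        (hwi ▸ hi x hxa hxb fun h => hxw (h ▸ hwi.symm))
    by_cases hxi : x = i
    · exact hf.not_adj (x := x) (by simp [hxa, hxb]) hux
        (hxi ▸ (hi w hw.1 hw.2 (Ne.symm hwi)).symm)
    · exact hxw (hf.eq_of_adj_adj (y := i) (by simp [hxa, hxb]) hux (by simp [hia, hib])
        (hi w hw.1 hw.2 (Ne.symm hwi)).symm (hi x hxa hxb (Ne.symm hxi)))
  obtain ⟨l, hla, hlb, hlw⟩ := hQ2 w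
  rcases hu with rfl | rfl
  · exact ⟨b, w, Ne.symm hw.2, adj_iff_of_adj_of_unique_neighbor hne.symm hadj.symm
      (fun k hkb hka => (hcov k hka hkb).symm)
      (fun i k hib hia hkb hka => hclb i k hia hib hka hkb) (fun i hib hia => ha i hia hib)
      hw.2 hw.1 huw (fun x hxb h => huniq x h.ne' hxb h) hlb hla hlw⟩
  · exact ⟨a, w, Ne.symm hw.1, adj_iff_of_adj_of_unique_neighbor hne hadj hcov hcla hb
      hw.1 hw.2 huw (fun x hxa h => huniq x hxa h.ne' h) hla hlb hlw⟩

theorem nonempty_iso_completeBipartiteGraph {m n : ℕ} [Finite V] {s : Set V}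
    (hs : s.ncard = m) (hsc : sᶜ.ncard = n) (h : ∀ x y, G.Adj x y ↔ (x ∈ s ↔ y ∉ s)) :
    Nonempty (G ≃g completeBipartiteGraph (Fin m) (Fin n)) := by
  classical
  have e₁ : s ≃ Fin m := (Finite.equivFin s).trans (finCongr hs)
  have e₂ : (sᶜ : Set V) ≃ Fin n := (Finite.equivFin _).trans (finCongr hsc)
  refine ⟨⟨(Equiv.Set.sumCompl s).symm.trans (Equiv.sumCongr e₁ e₂), ?_⟩⟩
  intro x y
  rw [h]
  by_cases hx : x ∈ s <;> by_cases hy : y ∈ s <;>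
    simp [hx, hy, Equiv.Set.sumCompl_symm_apply_of_mem, Equiv.Set.sumCompl_symm_apply_of_notMem]

end Structure

/-! ### Forcing sets of `K_{2,q}`. -/

section CompleteBipartite

variable {q : ℕ}

theorem not_isIsolated_completeBipartiteGraph_two (hq : 2 ≤ q) (w : Fin 2 ⊕ Fin q) :
    ¬ (completeBipartiteGraph (Fin 2) (Fin q)).IsIsolated w := by
  intro h
  rcases w with c | i
  · exact h (.inr ⟨0, by omega⟩) (by simp)
  · exact h (.inl 0) (by simp)

theorem isPSDForcingSet_of_range_inl_subset {S : Set (Fin 2 ⊕ Fin q)} (h : ∀ c, .inl c ∈ S) :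
    IsPSDForcingSet (completeBipartiteGraph (Fin 2) (Fin q)) S := by
  refine isPSDForcingSet_of_forall_superset fun T hST hT => ?_
  obtain ⟨w, hw⟩ := (Set.ne_univ_iff_exists_notMem T).1 hT
  rcases w with c | i
  · exact absurd (hST (h c)) hw
  · refine ⟨.inl 0, .inr i, psdForces_of_isolated (hST (h 0)) (by simp) hw ?_⟩
    rintro (c | j) hx
    · exact absurd (hST (h c)) hx
    · simp

theorem isPSDForcingSet_of_range_inr_subset (hq : 2 ≤ q) {S : Set (Fin 2 ⊕ Fin q)}
    (h : ∀ i, .inr i ∈ S) : IsPSDForcingSet (completeBipartiteGraph (Fin 2) (Fin q)) S := by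
  refine isPSDForcingSet_of_forall_superset fun T hST hT => ?_
  obtain ⟨w, hw⟩ := (Set.ne_univ_iff_exists_notMem T).1 hT
  rcases w with c | i
  · refine ⟨.inr ⟨0, by omega⟩, .inl c, psdForces_of_isolated (hST (h _)) (by simp) hw ?_⟩
    rintro (d | j) hx
    · simp
    · exact absurd (hST (h j)) hx
  · exact absurd (hST (h i)) hw

theorem isPSDForcingSet_of_inl_mem_of_inr_mem {S : Set (Fin 2 ⊕ Fin q)} {c : Fin 2} {i : Fin q}
    (hc : .inl c ∈ S) (hi : .inr i ∈ S) :
    IsPSDForcingSet (completeBipartiteGraph (Fin 2) (Fin q)) S := by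
  by_cases h : ∀ d, .inl d ∈ S
  · exact isPSDForcingSet_of_range_inl_subset h
  push Not at h
  obtain ⟨d, hd⟩ := h
  have hdc : ∀ e : Fin 2, e = c ∨ e = d := by
    have : c ≠ d := by rintro rfl; exact hd hc
    omega
  refine .of_insert (u := .inr i) (w := .inl d)
    (psdForces_of_unique hi (by simp) hd ?_) (isPSDForcingSet_of_range_inl_subset fun e => ?_)
  · rintro (e | j) hx h
    · rcases hdc e with rfl | rfl
      exacts [absurd hc hx, rfl]
    · simp at h
  · rcases hdc e with rfl | rfl
    exacts [.inr hc, .inl rfl]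

/-- Every blue vertex sees both left vertices, which are joined through the white vertex `k`. -/
theorem not_isPSDForcingSet_of_inl_notMem_of_inr_notMem {S : Set (Fin 2 ⊕ Fin q)} {k : Fin q}
    (hc : ∀ c, .inl c ∉ S) (hk : .inr k ∉ S) :
    ¬ IsPSDForcingSet (completeBipartiteGraph (Fin 2) (Fin q)) S := by
  intro h
  obtain ⟨u, w, hf⟩ := h.exists_forces hk
  have hu := hf.1
  have huw := hf.2.1
  rcases u with c | i
  · exact hc c hu
  rcases w with c | j
  · have h : ∀ d : Fin 2, (Sum.inl d : Fin 2 ⊕ Fin q) = .inl c := fun d =>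
      hf.eq_of_adj_adj (y := .inr k) (hc d) (by simp) hk (by simp) (by simp)
    have := (h 0).trans (h 1).symm
    simp at this
  · simp at huw

end CompleteBipartite

theorem propositionp (q : ℕ) (hq : 2 ≤ q) :
    HasUniquePSDTARGraph.{u} (completeBipartiteGraph (Fin 2) (Fin q)) := by
  refine ⟨not_isIsolated_completeBipartiteGraph_two hq, fun V _ G hG ⟨φ⟩ => ?_⟩
  obtain ⟨e, he⟩ := exists_equiv_isPSDForcingSet_iff hG
    (not_isIsolated_completeBipartiteGraph_two hq) φ
  have hmem : ∀ (S : Set V) y, y ∈ e '' S ↔ e.symm y ∈ S := fun S y => by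
    rw [e.image_eq_preimage_symm]; rfl
  have hcases : ∀ x, x = e.symm (.inl 0) ∨ x = e.symm (.inl 1) ∨ ∃ i, x = e.symm (.inr i) := by
    intro x
    obtain ⟨y, rfl⟩ := e.symm.surjective x
    rcases y with c | i
    · fin_cases c <;> simp
    · exact .inr (.inr ⟨i, rfl⟩)
  have hne : e.symm (.inl 0) ≠ e.symm (.inl 1) := by simp
  suffices ∃ c d, c ≠ d ∧ ∀ x y, G.Adj x y ↔ (x ∈ ({c, d} : Set V) ↔ y ∉ ({c, d} : Set V)) by
    obtain ⟨c, d, hcd, h⟩ := this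
    have hs : ({c, d} : Set V).ncard = 2 := Set.ncard_pair hcd
    have hV : Nat.card V = 2 + q := by rw [Nat.card_congr e]; simp
    refine nonempty_iso_completeBipartiteGraph hs ?_ h
    have := Set.ncard_add_ncard_compl ({c, d} : Set V)
    omega
  refine exists_adj_iff hne hG ?_ ?_ ?_ ?_ ?_ ?_
  · intro k
    by_cases hk : k = e.symm (.inr ⟨0, by omega⟩)
    · exact ⟨e.symm (.inr ⟨1, by omega⟩), by simp, by simp, by simp [hk]⟩
    · exact ⟨e.symm (.inr ⟨0, by omega⟩), by simp, by simp, Ne.symm hk⟩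
  -- Adding any one of the three white vertices gives a forcing set, so a force here would make a
  -- non-forcing set forcing.
  · intro k hka hkb u w hf
    obtain ⟨k, rfl⟩ := ((hcases k).resolve_left hka).resolve_left hkb
    have hw := hf.2.2.1
    refine not_isPSDForcingSet_of_inl_notMem_of_inr_notMem (k := k) ?_ ?_
      ((he _).1 (.of_insert hf ((he _).2 ?_)))
    · intro c; rw [hmem]; fin_cases c <;> simp
    · rw [hmem]; simp
    · have hblue : ∀ i, i ≠ k →
          .inr i ∈ e '' insert w ({e.symm (.inl 0), e.symm (.inl 1), e.symm (.inr k)} : Set V)ᶜ := by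
        intro i hi; rw [hmem]; right; simp [hi]
      obtain ⟨j, hj⟩ : ∃ j, j ≠ k := by
        have : Nontrivial (Fin q) := Fin.nontrivial_iff_two_le.2 hq
        exact exists_ne k
      have hwmem : e w ∈
          e '' insert w ({e.symm (.inl 0), e.symm (.inl 1), e.symm (.inr k)} : Set V)ᶜ :=
        Set.mem_image_of_mem e (Set.mem_insert _ _)
      rw [compl_compl] at hw
      rcases hw with rfl | rfl | rfl
      · rw [e.apply_symm_apply] at hwmem
        exact isPSDForcingSet_of_inl_mem_of_inr_mem hwmem (hblue j hj)
      · rw [e.apply_symm_apply] at hwmem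
        exact isPSDForcingSet_of_inl_mem_of_inr_mem hwmem (hblue j hj)
      · rw [e.apply_symm_apply] at hwmem
        refine isPSDForcingSet_of_range_inr_subset hq fun i => ?_
        by_cases hi : i = k
        exacts [hi ▸ hwmem, hblue i hi]
  · refine (he _).2 (isPSDForcingSet_of_range_inl_subset fun c => ?_)
    rw [hmem]; fin_cases c <;> simp
  · intro i hia hib
    obtain ⟨i, rfl⟩ := ((hcases i).resolve_left hia).resolve_left hib
    refine (he _).2 (isPSDForcingSet_of_inl_mem_of_inr_mem (c := 0) (i := i) ?_ ?_) <;>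
      rw [hmem] <;> simp
  · intro i hia hib
    obtain ⟨i, rfl⟩ := ((hcases i).resolve_left hia).resolve_left hib
    refine (he _).2 (isPSDForcingSet_of_inl_mem_of_inr_mem (c := 1) (i := i) ?_ ?_) <;>
      rw [hmem] <;> simp
  · refine (he _).2 (isPSDForcingSet_of_range_inr_subset hq fun i => ?_)
    rw [hmem]; simp
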